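/- For a window $h=(h_1,\dots,h_N)\in\mathbb{C}^N$ with $\sum_n |h_n|^2=1$ and more than one nonzero entry, let $\mathbf{x}(\omega)\in\mathbb{C}^N$ be the windowed sinusoid with entries $h_n e^{j\omega(n-(N+1)/2)}$, $n=1,\dots,N$, where $j=\sqrt{-1}$. For $K\ge 1$ and $\boldsymbol{\omega}=(\omega_1,\dots,\omega_K)\in\mathbb{R}^K$ let $\mathbf{X}(\boldsymbol{\omega})=[\mathbf{x}(\omega_1)\ \cdots\ \mathbf{x}(\omega_K)]\in\mathbb{C}^{N\times K}$, and for $\delta>0$ let $\Lambda_p(\delta)$ be the set of all $\boldsymbol{\omega}\in\mathbb{R}^K$ for which the smallest singular value $\min_{\mathbf{g}\neq 0}\|\mathbf{X}(\boldsymbol{\omega})\mathbf{g}\|/\|\mathbf{g}\|$ of $\mathbf{X}(\boldsymbol{\omega})$ is at least $\delta$ (all vector norms are Euclidean). Let $\mathbf{A}$ be a random $M\times N$ matrix, $M\ge 1$, with entries i.i.d. uniform on $\{\pm 1/\sqrt N,\pm j/\sqrt N\}$. Then for every $c>0$ there is a constant $C>0$, depending only on $c$, such that for all $N,K,M$ and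 $h$ as above, all $\epsilon>0$ and all $\delta>0$ with $$M\ \ge\ C\,\epsilon^{-2}K\log\left(NK\epsilon^{-1}\delta^{-1}\right),$$ with probability at least $1-\left(NK\epsilon^{-1}\delta^{-1}\right)^{-c}$ the following holds simultaneously for all $\boldsymbol{\omega}\in\Lambda_p(\delta)$ and all nonzero $\mathbf{g}\in\mathbb{C}^K$: $$1-\epsilon\ \le\ \sqrt{\frac{N}{M}}\;\frac{\|\mathbf{A}\mathbf{X}(\boldsymbol{\omega})\mathbf{g}\|}{\|\mathbf{X}(\boldsymbol{\omega})\mathbf{g}\|}\ \le\ 1+\epsilon .$$ -/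

import Mathlib

open MeasureTheory ProbabilityTheory

noncomputable section

namespace CompressiveSinusoids

/-- The Euclidean norm of a complex vector. -/
def euclNorm {n : ℕ} (v : Fin n → ℂ) : ℝ := ‖WithLp.toLp 2 v‖

/-- The windowed sinusoid of frequency `w`: its entries, indexed by `n = 0, …, N - 1`, are
`h n * exp (j * w * (n - (N - 1) / 2))`. -/
def sinusoid {N : ℕ} (h : Fin N → ℂ) (w : ℝ) (n : Fin N) : ℂ :=
  h n * Complex.exp (Complex.I * (w : ℂ) * ((n : ℂ) - ((N : ℂ) - 1) / 2))

/-- The `N × K` matrix whose columns are the windowed sinusoids of frequencies `w 0, …, w (K-1)`. -/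
def sinusoidMatrix {N K : ℕ} (h : Fin N → ℂ) (w : Fin K → ℝ) : Matrix (Fin N) (Fin K) ℂ :=
  Matrix.of fun n l => sinusoid h (w l) n

/-- The smallest singular value of an `N × K` matrix, `min ‖X g‖ / ‖g‖` over nonzero `g`
(used for `1 ≤ K`). -/
def smallestSingularValue {N K : ℕ} (X : Matrix (Fin N) (Fin K) ℂ) : ℝ :=
  ⨅ g : {g : Fin K → ℂ // g ≠ 0}, euclNorm (X.mulVec g.1) / euclNorm g.1

/-- The frequency tuples whose sinusoid matrix has smallest singular value at least `δ`. -/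
def wellConditioned {N : ℕ} (K : ℕ) (h : Fin N → ℂ) (δ : ℝ) : Set (Fin K → ℝ) :=
  {w | δ ≤ smallestSingularValue (sinusoidMatrix h w)}

/-- The isometry with constant `ε` for all mixtures of `K` sinusoids whose frequency tuple is
`δ`-well-conditioned. -/
def IsMixtureIsometry {M N : ℕ} (K : ℕ) (h : Fin N → ℂ) (δ ε : ℝ)
    (A : Matrix (Fin M) (Fin N) ℂ) : Prop :=
  ∀ w ∈ wellConditioned K h δ, ∀ g : Fin K → ℂ, g ≠ 0 →
    1 - ε ≤ √((N : ℝ) / M) *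
        (euclNorm (A.mulVec ((sinusoidMatrix h w).mulVec g)) /
          euclNorm ((sinusoidMatrix h w).mulVec g)) ∧
    √((N : ℝ) / M) *
        (euclNorm (A.mulVec ((sinusoidMatrix h w).mulVec g)) /
          euclNorm ((sinusoidMatrix h w).mulVec g)) ≤ 1 + ε

/-- The four values `±1/√N`, `±j/√N` of the projection weights. -/
def weightValues (N : ℕ) : Set ℂ :=
  {1 / (√(N : ℝ) : ℂ), -(1 / (√(N : ℝ) : ℂ)),
    Complex.I / (√(N : ℝ) : ℂ), -(Complex.I / (√(N : ℝ) : ℂ))}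

/-- A random `M × N` matrix whose entries are i.i.d. uniform on `{±1/√N, ±j/√N}`. -/
structure IsRandomMeasurementMatrix {Ω : Type*} [MeasurableSpace Ω] (P : Measure Ω) {M N : ℕ}
    (A : Ω → Matrix (Fin M) (Fin N) ℂ) : Prop where
  indep : iIndepFun (fun (p : Fin M × Fin N) (x : Ω) => A x p.1 p.2) P
  law : ∀ i k, HasLaw (fun x => A x i k) (uniformOn (weightValues N)) P

end CompressiveSinusoids

end

noncomputable section

namespace CompressiveSinusoids

/-! For a fixed unit vector `y`, one measurement scaled by `√N` is a sum of independent centred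
terms whose moment generating function is dominated by that of a standard complex Gaussian. Hence
its squared modulus satisfies the exponential-moment bound `(1 - t)⁻¹`
(`integral_exp_sq_norm_row_le`), and a Chernoff bound over the `M` independent rows makes a relative
deviation `e` exponentially unlikely in `M * e ^ 2` (`matrixLaw_not_near_isometry_le`).

Uniformity comes from a finite net. Conditioning enters only here: if `X g` has norm 1, the
coefficients have modulus at most `δ⁻¹`, so the mixtures to control depend on `3 * K` bounded real
parameters. With `Q = N * K * ε⁻¹ * δ⁻¹`, a sufficiently fine net has at most `Q ^ (64 * K)` points
(`exists_net_parameters`). The step from the net to all mixtures (`isMixtureIsometry_of_net`) needs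
no operator-norm estimate for the random matrix: the deterministic bound
`scaledNorm_le_of_mem_weightValues` loses only `√N`, which a finer mesh absorbs. The union bound
then closes because `M * ε ^ 2` dominates `K * log Q`. -/

/-! ### Laws of the weights, rows and matrices -/

lemma finite_weightValues (N : ℕ) : (weightValues N).Finite := by
  unfold weightValues; exact Set.toFinite _

instance isProbabilityMeasure_weights (N : ℕ) :
    IsProbabilityMeasure (uniformOn (weightValues N)) :=
  isProbabilityMeasure_uniformOn (finite_weightValues N) ⟨_, Or.inl rfl⟩

/-- The uniform law on the weights is the average of four point masses. -/
lemma uniformOn_weightValues_eq {N : ℕ} (hN : 1 ≤ N) :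
    uniformOn (weightValues N) = (4⁻¹ : ENNReal) •
      (Measure.dirac (1 / (√(N : ℝ) : ℂ)) + Measure.dirac (-(1 / (√(N : ℝ) : ℂ))) +
        Measure.dirac (Complex.I / (√(N : ℝ) : ℂ)) +
        Measure.dirac (-(Complex.I / (√(N : ℝ) : ℂ)))) := by
  classical
  have hs : (0 : ℝ) < √(N : ℝ) := Real.sqrt_pos.2 (by exact_mod_cast hN)
  set a : ℂ := 1 / (√(N : ℝ) : ℂ) with ha
  have hIa : Complex.I / (√(N : ℝ) : ℂ) = Complex.I * a := by rw [ha]; ring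
  have ha0 : a ≠ 0 := by
    rw [ha]; simpa using hs.ne'
  have h1 : a ≠ -a := fun h => ha0 (self_eq_neg.1 h)
  have hI : Complex.I * a ≠ -(Complex.I * a) := fun h =>
    mul_ne_zero Complex.I_ne_zero ha0 (self_eq_neg.1 h)
  have h2 : a ≠ Complex.I * a := fun h => by
    have : (1 : ℂ) = Complex.I := mul_right_cancel₀ ha0 (by rw [one_mul]; exact h)
    simpa using congrArg Complex.re this
  have h3 : a ≠ -(Complex.I * a) := fun h => by
    have : (1 : ℂ) = -Complex.I := mul_right_cancel₀ ha0 (by rw [one_mul, neg_mul]; exact h)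
    simpa using congrArg Complex.re this
  have h4 : -a ≠ Complex.I * a := fun h => h3 (by rw [← h, neg_neg])
  have h5 : -a ≠ -(Complex.I * a) := fun h => h2 (neg_injective h)
  have hw : weightValues N = (({a, -a, Complex.I * a, -(Complex.I * a)} : Finset ℂ) : Set ℂ) := by
    simp [weightValues, hIa, ← ha]
  have hcard : ({a, -a, Complex.I * a, -(Complex.I * a)} : Finset ℂ).card = 4 := by
    rw [Finset.card_insert_of_notMem, Finset.card_insert_of_notMem, Finset.card_insert_of_notMem,
      Finset.card_singleton] <;> simp [h1, h2, h3, h4, h5, hI]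
  have hcount : Measure.count (weightValues N) = 4 := by
    rw [hw, Measure.count_apply_finset, hcard]; norm_num
  rw [hIa]
  refine Measure.ext fun t ht => ?_
  rw [uniformOn, cond_apply (finite_weightValues N).measurableSet, hcount, Measure.smul_apply,
    smul_eq_mul]
  congr 1
  have hsum : Measure.count (weightValues N ∩ t) =
      ∑ x ∈ ({a, -a, Complex.I * a, -(Complex.I * a)} : Finset ℂ), t.indicator 1 x := by
    have : (({a, -a, Complex.I * a, -(Complex.I * a)} : Finset ℂ) : Set ℂ) ∩ t =
        ((({a, -a, Complex.I * a, -(Complex.I * a)} : Finset ℂ).filter (· ∈ t) : Finset ℂ) :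
          Set ℂ) := by
      ext x; simp
    rw [hw, this, Measure.count_apply_finset, Finset.card_filter]
    push_cast
    refine Finset.sum_congr rfl fun x _ => ?_
    simp [Set.indicator]
  rw [hsum, Finset.sum_insert (by simp [h1, h2, h3]), Finset.sum_insert (by simp [h4, h5]),
    Finset.sum_insert (by simp [hI]), Finset.sum_singleton]
  simp only [Measure.add_apply, Measure.dirac_apply' _ ht]
  ring

lemma integrable_weights {N : ℕ} (hN : 1 ≤ N) (f : ℂ → ℝ) :
    Integrable f (uniformOn (weightValues N)) := by
  rw [uniformOn_weightValues_eq hN]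
  refine Integrable.smul_measure ?_ (by norm_num)
  simp only [integrable_add_measure]
  exact ⟨⟨⟨integrable_dirac (by simp), integrable_dirac (by simp)⟩, integrable_dirac (by simp)⟩,
    integrable_dirac (by simp)⟩

lemma integral_weights {N : ℕ} (hN : 1 ≤ N) (f : ℂ → ℝ) :
    ∫ b, f b ∂uniformOn (weightValues N) =
      (f (1 / (√(N : ℝ) : ℂ)) + f (-(1 / (√(N : ℝ) : ℂ))) +
        f (Complex.I / (√(N : ℝ) : ℂ)) + f (-(Complex.I / (√(N : ℝ) : ℂ)))) / 4 := by
  have hd : ∀ x : ℂ, Integrable f (Measure.dirac x) := fun x => integrable_dirac (by simp)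
  rw [uniformOn_weightValues_eq hN, integral_smul_measure,
    integral_add_measure (((hd _).add_measure (hd _)).add_measure (hd _)) (hd _),
    integral_add_measure ((hd _).add_measure (hd _)) (hd _),
    integral_add_measure (hd _) (hd _)]
  simp only [integral_dirac, smul_eq_mul, ENNReal.toReal_inv, ENNReal.toReal_ofNat]
  ring

lemma ae_mem_weightValues (N : ℕ) :
    ∀ᵐ b ∂uniformOn (weightValues N), b ∈ weightValues N :=
  ae_cond_mem (finite_weightValues N).measurableSet

lemma sq_norm_of_mem_weightValues {N : ℕ} {b : ℂ} (hb : b ∈ weightValues N) :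
    ‖b‖ ^ 2 = (N : ℝ)⁻¹ := by
  rcases hb with rfl | rfl | rfl | rfl <;>
    simp [inv_pow]

/-- The law of a row of the random measurement matrix. -/
def rowLaw (N : ℕ) : Measure (Fin N → ℂ) := Measure.pi fun _ => uniformOn (weightValues N)

instance (N : ℕ) : IsProbabilityMeasure (rowLaw N) := by unfold rowLaw; infer_instance

/-- The law of the random measurement matrix, as a family of rows. -/
def matrixLaw (M N : ℕ) : Measure (Fin M → Fin N → ℂ) := Measure.pi fun _ => rowLaw N

instance (M N : ℕ) : IsProbabilityMeasure (matrixLaw M N) := by unfold matrixLaw; infer_instance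

lemma ae_row_mem (N : ℕ) : ∀ᵐ r ∂rowLaw N, ∀ n, r n ∈ weightValues N := by
  rw [ae_all_iff]
  intro n
  exact (Measure.quasiMeasurePreserving_eval _ n).ae (ae_mem_weightValues N)

lemma ae_matrix_mem (M N : ℕ) :
    ∀ᵐ A ∂matrixLaw M N, ∀ i n, A i n ∈ weightValues N := by
  rw [ae_all_iff]
  intro i
  exact (Measure.quasiMeasurePreserving_eval (fun _ : Fin M => rowLaw N) i).ae (ae_row_mem N)

/-- Finitely supported weights put the row and matrix laws on compact sets, so every integrand below
is integrable by continuity alone. -/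
lemma integrable_of_ae_mem_isCompact {X : Type*} [TopologicalSpace X] [MeasurableSpace X]
    [OpensMeasurableSpace X] [T2Space X] [SecondCountableTopologyEither X ℝ] {μ : Measure X}
    [IsFiniteMeasure μ] {s : Set X} (hs : IsCompact s) (h : ∀ᵐ x ∂μ, x ∈ s) {f : X → ℝ}
    (hf : Continuous f) : Integrable f μ := by
  have := hf.continuousOn.integrableOn_compact (μ := μ) hs
  rwa [IntegrableOn, Measure.restrict_eq_self_of_ae_mem h] at this

lemma integrable_rowLaw {N : ℕ} {f : (Fin N → ℂ) → ℝ} (hf : Continuous f) :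
    Integrable f (rowLaw N) :=
  integrable_of_ae_mem_isCompact
    (isCompact_univ_pi fun _ : Fin N => (finite_weightValues N).isCompact)
    ((ae_row_mem N).mono fun _ h n _ => h n) hf

lemma integrable_matrixLaw {M N : ℕ} {f : (Fin M → Fin N → ℂ) → ℝ} (hf : Continuous f) :
    Integrable f (matrixLaw M N) :=
  integrable_of_ae_mem_isCompact
    (isCompact_univ_pi fun _ : Fin M =>
      isCompact_univ_pi fun _ : Fin N => (finite_weightValues N).isCompact)
    ((ae_matrix_mem M N).mono fun _ h i _ n _ => h i n) hf

/-! ### Exponential moments of one measurement -/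

/-- Sum-to-product comes before `cosh x ≤ exp (x ^ 2 / 2)`: bounding each term separately leaves an
average of exponentials, which by convexity exceeds the exponential of the average. -/
lemma cosh_add_cosh_le (p q : ℝ) :
    (Real.cosh p + Real.cosh q) / 2 ≤ Real.exp ((p ^ 2 + q ^ 2) / 4) := by
  have h : (Real.cosh p + Real.cosh q) / 2 = Real.cosh ((p + q) / 2) * Real.cosh ((p - q) / 2) := by
    have h1 := Real.cosh_add ((p + q) / 2) ((p - q) / 2)
    have h2 := Real.cosh_sub ((p + q) / 2) ((p - q) / 2)
    ring_nf at h1 h2 ⊢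
    linarith
  rw [h]
  calc _ ≤ Real.exp (((p + q) / 2) ^ 2 / 2) * Real.exp (((p - q) / 2) ^ 2 / 2) :=
        mul_le_mul (Real.cosh_le_exp_half_sq _) (Real.cosh_le_exp_half_sq _)
          (Real.cosh_pos _).le (Real.exp_pos _).le
    _ = _ := by rw [← Real.exp_add]; congr 1; ring

/-- Pythagoras: `a` and `I * a` are orthogonal of equal length in the real plane. -/
lemma inner_I_mul_sq (a v : ℂ) :
    inner ℝ a v ^ 2 + inner ℝ (Complex.I * a) v ^ 2 = ‖a‖ ^ 2 * ‖v‖ ^ 2 := by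
  simp only [Complex.inner, Complex.sq_norm, Complex.normSq_apply, Complex.mul_re, Complex.mul_im,
    Complex.conj_re, Complex.conj_im, Complex.I_re, Complex.I_im]
  ring

/-- Opposite weights pair into hyperbolic cosines along the directions `a` and `I * a`, and the sum
of the two squares is isotropic in `v`. -/
lemma integral_exp_inner_weight_le {N : ℕ} (hN : 1 ≤ N) (s : ℝ) (a v : ℂ) :
    ∫ b, Real.exp (√(N : ℝ) * s * inner ℝ (b * a) v) ∂uniformOn (weightValues N) ≤
      Real.exp (s ^ 2 * ‖v‖ ^ 2 * ‖a‖ ^ 2 / 4) := by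
  have hs : √(N : ℝ) ≠ 0 := (Real.sqrt_pos.2 (by exact_mod_cast hN)).ne'
  have key : ∀ z : ℂ, √(N : ℝ) * s * inner ℝ (z / (√(N : ℝ) : ℂ) * a) v = s * inner ℝ (z * a) v := by
    intro z
    have : z / (√(N : ℝ) : ℂ) * a = (√(N : ℝ))⁻¹ • (z * a) := by
      rw [Complex.real_smul, Complex.ofReal_inv]; ring
    rw [this, real_inner_smul_left]
    field_simp
  rw [integral_weights hN]
  simp only [neg_mul, inner_neg_left, mul_neg, key, one_mul]
  refine le_of_eq_of_le ?_ ((cosh_add_cosh_le (s * inner ℝ a v)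
    (s * inner ℝ (Complex.I * a) v)).trans_eq ?_)
  · rw [Real.cosh_eq, Real.cosh_eq]; ring
  · congr 1
    rw [mul_pow, mul_pow, ← mul_add, inner_I_mul_sq]; ring

lemma integral_exp_inner_row_le {N : ℕ} (hN : 1 ≤ N) {y : Fin N → ℂ} (hy : ∑ n, ‖y n‖ ^ 2 = 1)
    (s : ℝ) (v : ℂ) :
    ∫ r, Real.exp (√(N : ℝ) * s * inner ℝ (r ⬝ᵥ y) v) ∂rowLaw N ≤
      Real.exp (s ^ 2 * ‖v‖ ^ 2 / 4) := by
  have h : ∀ r : Fin N → ℂ, Real.exp (√(N : ℝ) * s * inner ℝ (r ⬝ᵥ y) v) =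
      ∏ n, Real.exp (√(N : ℝ) * s * inner ℝ (r n * y n) v) := by
    intro r
    rw [← Real.exp_sum, dotProduct, sum_inner, Finset.mul_sum]
  simp_rw [h]
  rw [rowLaw, integral_fintype_prod_eq_prod
    (fun n b => Real.exp (√(N : ℝ) * s * inner ℝ (b * y n) v))]
  calc _ ≤ ∏ n, Real.exp (s ^ 2 * ‖v‖ ^ 2 * ‖y n‖ ^ 2 / 4) :=
        Finset.prod_le_prod (fun n _ => integral_nonneg fun _ => (Real.exp_pos _).le)
          fun n _ => integral_exp_inner_weight_le hN s (y n) v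
    _ = _ := by
        rw [← Real.exp_sum, ← Finset.sum_div, ← Finset.mul_sum, hy, mul_one]

lemma integrable_gaussian_complex {b : ℝ} (hb : 0 < b) (c : ℝ) (w : ℂ) :
    Integrable fun v : ℂ => Real.exp (-b * ‖v‖ ^ 2 + c * inner ℝ w v) := by
  have := (GaussianFourier.integrable_cexp_neg_mul_sq_norm_add (V := ℂ) (b := b)
    (by simpa using hb) c w).norm
  refine this.congr (Filter.Eventually.of_forall fun v => ?_)
  simp only [Complex.norm_exp]
  norm_cast

lemma integral_gaussian_complex_inner {b : ℝ} (hb : 0 < b) (c : ℝ) (w : ℂ) :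
    ∫ v : ℂ, Real.exp (-b * ‖v‖ ^ 2 + c * inner ℝ w v) =
      Real.pi / b * Real.exp (c ^ 2 * ‖w‖ ^ 2 / (4 * b)) := by
  have := GaussianFourier.integral_cexp_neg_mul_sq_norm_add (V := ℂ) (b := b)
    (by simpa using hb) c w
  rw [Complex.finrank_real_complex] at this
  norm_num at this
  norm_cast at this
  rw [← this]
  refine integral_congr_ae (Filter.Eventually.of_forall fun v => ?_)
  simp only [Complex.inner, Complex.mul_re, Complex.conj_re, Complex.conj_im]
  congr 1
  ring

/-- Gaussian linearization: `exp (t * |z| ^ 2)` is, up to the factor `π`, a Gaussian integral over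
`v` of exponentials linear in `z`. After exchanging integrals the linear bound applies for each `v`,
and the remaining integral of `exp (-(1 - t) * ‖v‖ ^ 2)` is explicit. -/
lemma integral_exp_sq_norm_row_le {N : ℕ} (hN : 1 ≤ N) {y : Fin N → ℂ}
    (hy : ∑ n, ‖y n‖ ^ 2 = 1) {t : ℝ} (ht : 0 ≤ t) (ht1 : t < 1) :
    ∫ r, Real.exp (t * (N * ‖r ⬝ᵥ y‖ ^ 2)) ∂rowLaw N ≤ (1 - t)⁻¹ := by
  have hcont : Continuous fun r : Fin N → ℂ => r ⬝ᵥ y := by unfold dotProduct; fun_prop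
  -- The factor `2 * √t` makes completing the square in `v` produce exactly `t * N * ‖r ⬝ᵥ y‖ ^ 2`.
  set F : (Fin N → ℂ) → ℂ → ℝ := fun r v =>
    Real.exp (-1 * ‖v‖ ^ 2 + (√(N : ℝ) * (2 * √t)) * inner ℝ (r ⬝ᵥ y) v) with hF
  have hFc : Continuous fun p : (Fin N → ℂ) × ℂ => F p.1 p.2 := by
    simp only [hF]
    have : Continuous fun p : (Fin N → ℂ) × ℂ => p.1 ⬝ᵥ y := hcont.comp continuous_fst
    fun_prop
  have h1 : ∀ r, ∫⁻ v, ENNReal.ofReal (F r v) =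
      ENNReal.ofReal (Real.pi * Real.exp (t * (N * ‖r ⬝ᵥ y‖ ^ 2))) := by
    intro r
    rw [← ofReal_integral_eq_lintegral_ofReal (integrable_gaussian_complex one_pos _ _)
      (Filter.Eventually.of_forall fun _ => (Real.exp_pos _).le),
      integral_gaussian_complex_inner one_pos]
    congr 2
    · ring
    · congr 1
      rw [mul_pow, mul_pow, Real.sq_sqrt (Nat.cast_nonneg N), Real.sq_sqrt ht]; ring
  have h2 : ∀ v, ∫⁻ r, ENNReal.ofReal (F r v) ∂rowLaw N ≤
      ENNReal.ofReal (Real.exp (-(1 - t) * ‖v‖ ^ 2)) := by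
    intro v
    have hi : Integrable (fun r => F r v) (rowLaw N) :=
      integrable_rowLaw (hFc.comp (Continuous.prodMk_left v))
    rw [← ofReal_integral_eq_lintegral_ofReal hi
      (Filter.Eventually.of_forall fun _ => (Real.exp_pos _).le)]
    refine ENNReal.ofReal_le_ofReal ?_
    simp only [hF, Real.exp_add, integral_const_mul]
    calc _ ≤ Real.exp (-1 * ‖v‖ ^ 2) * Real.exp ((2 * √t) ^ 2 * ‖v‖ ^ 2 / 4) :=
          mul_le_mul_of_nonneg_left (integral_exp_inner_row_le hN hy _ _) (Real.exp_pos _).le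
      _ = _ := by
          rw [← Real.exp_add, mul_pow, Real.sq_sqrt ht]; congr 1; ring
  have h3 : ENNReal.ofReal (Real.pi * ∫ r, Real.exp (t * (N * ‖r ⬝ᵥ y‖ ^ 2)) ∂rowLaw N) ≤
      ENNReal.ofReal (Real.pi / (1 - t)) := by
    rw [← integral_const_mul, ofReal_integral_eq_lintegral_ofReal
      (integrable_rowLaw (by fun_prop))
      (Filter.Eventually.of_forall fun _ => by positivity)]
    simp_rw [← h1]
    -- Tonelli for nonnegative integrands, so joint integrability need not be checked.
    rw [lintegral_lintegral_swap (hFc.measurable.ennreal_ofReal.aemeasurable)]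
    refine (lintegral_mono h2).trans_eq ?_
    have hi := integrable_gaussian_complex (sub_pos.2 ht1) 0 0
    have he := integral_gaussian_complex_inner (sub_pos.2 ht1) 0 0
    simp only [inner_zero_left, mul_zero, add_zero, norm_zero] at hi he
    rw [← ofReal_integral_eq_lintegral_ofReal hi
      (Filter.Eventually.of_forall fun _ => (Real.exp_pos _).le), he]
    simp
  have h4 := (ENNReal.ofReal_le_ofReal_iff (div_nonneg Real.pi_pos.le (sub_pos.2 ht1).le)).1 h3
  rw [div_eq_mul_inv] at h4
  exact le_of_mul_le_mul_left h4 Real.pi_pos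

/-! ### Second moment and the negative exponential moment -/

lemma continuous_dotProduct_left {N : ℕ} (y : Fin N → ℂ) :
    Continuous fun r : Fin N → ℂ => r ⬝ᵥ y := by
  unfold dotProduct; fun_prop

/-- The summands are independent and centred, so variances add; each contributes `‖y n‖ ^ 2 / 2`,
the four weights being balanced between the two axes. -/
lemma integral_re_dotProduct_sq {N : ℕ} (hN : 1 ≤ N) (y : Fin N → ℂ) :
    ∫ r, (√(N : ℝ) * (r ⬝ᵥ y).re) ^ 2 ∂rowLaw N = (∑ n, ‖y n‖ ^ 2) / 2 := by
  have hs : √(N : ℝ) ≠ 0 := (Real.sqrt_pos.2 (by exact_mod_cast hN)).ne'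
  set X : Fin N → ℂ → ℝ := fun n b => √(N : ℝ) * (b * y n).re with hX
  have hval : ∀ n (z : ℂ), X n (z / (√(N : ℝ) : ℂ)) = (z * y n).re := by
    intro n z
    have : z / (√(N : ℝ) : ℂ) * y n = ((√(N : ℝ))⁻¹ : ℝ) * (z * y n) := by
      rw [Complex.ofReal_inv]; ring
    simp only [hX]
    rw [this, Complex.re_ofReal_mul, mul_inv_cancel_left₀ hs]
  have hvaln : ∀ n (z : ℂ), X n (-(z / (√(N : ℝ) : ℂ))) = -(z * y n).re := by
    intro n z
    rw [← neg_div, hval, neg_mul, Complex.neg_re]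
  have hmean : ∀ n, ∫ b, X n b ∂uniformOn (weightValues N) = 0 := by
    intro n
    rw [integral_weights hN, hval, hval, hvaln, hvaln]; ring
  have hmeas : ∀ n, Measurable (X n) := fun n => by
    simp only [hX]; fun_prop
  have hL : ∀ n, MemLp (X n) 2 (uniformOn (weightValues N)) := fun n =>
    (memLp_two_iff_integrable_sq (hmeas n).aestronglyMeasurable).2 (integrable_weights hN _)
  have hvar : ∀ n, Var[X n; uniformOn (weightValues N)] = ‖y n‖ ^ 2 / 2 := by
    intro n
    rw [variance_of_integral_eq_zero (hmeas n).aemeasurable (hmean n), integral_weights hN, hval,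
      hval, hvaln, hvaln, Complex.sq_norm, Complex.normSq_apply]
    simp
    ring
  have hsum : (fun r : Fin N → ℂ => √(N : ℝ) * (r ⬝ᵥ y).re) = ∑ n, fun r : Fin N → ℂ => X n (r n) := by
    ext r
    rw [Finset.sum_apply, dotProduct, Complex.re_sum, Finset.mul_sum]
  have hzero : ∫ r, √(N : ℝ) * (r ⬝ᵥ y).re ∂rowLaw N = 0 := by
    have : ∀ r : Fin N → ℂ, √(N : ℝ) * (r ⬝ᵥ y).re = ∑ n, X n (r n) := fun r => by
      rw [congrFun hsum r, Finset.sum_apply]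
    simp_rw [this]
    rw [integral_finsetSum _ fun n _ => integrable_rowLaw (by simp only [hX]; fun_prop)]
    refine Finset.sum_eq_zero fun n _ => ?_
    rw [← hmean n]
    exact integral_comp_eval (μ := fun _ : Fin N => uniformOn (weightValues N)) (i := n)
      (f := X n) (hmeas n).aestronglyMeasurable
  have hc : Continuous fun r : Fin N → ℂ => √(N : ℝ) * (r ⬝ᵥ y).re := by
    have := continuous_dotProduct_left y
    fun_prop
  rw [← variance_of_integral_eq_zero hc.measurable.aemeasurable hzero, hsum, rowLaw,
    variance_sum_pi hL, Finset.sum_div]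
  exact Finset.sum_congr rfl fun n _ => hvar n

lemma integral_sq_norm_row {N : ℕ} (hN : 1 ≤ N) {y : Fin N → ℂ} (hy : ∑ n, ‖y n‖ ^ 2 = 1) :
    ∫ r, (N * ‖r ⬝ᵥ y‖ ^ 2) ∂rowLaw N = 1 := by
  have hy' : ∑ n, ‖(Complex.I • y) n‖ ^ 2 = 1 := by simpa using hy
  -- The imaginary part is, up to sign, the real part for `I • y`.
  have h : ∀ r : Fin N → ℂ, N * ‖r ⬝ᵥ y‖ ^ 2 =
      (√(N : ℝ) * (r ⬝ᵥ y).re) ^ 2 + (√(N : ℝ) * (r ⬝ᵥ (Complex.I • y)).re) ^ 2 := by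
    intro r
    rw [dotProduct_smul, mul_pow, mul_pow, Real.sq_sqrt (Nat.cast_nonneg N), Complex.sq_norm,
      Complex.normSq_apply]
    simp
    ring
  simp_rw [h]
  have hc1 := continuous_dotProduct_left y
  have hc2 := continuous_dotProduct_left (Complex.I • y)
  rw [integral_add (integrable_rowLaw (by fun_prop)) (integrable_rowLaw (by fun_prop)),
    integral_re_dotProduct_sq hN, integral_re_dotProduct_sq hN, hy, hy']
  norm_num

lemma exp_neg_le_quadratic {x : ℝ} (hx : 0 ≤ x) : Real.exp (-x) ≤ 1 - x + x ^ 2 / 2 := by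
  rw [Real.exp_neg]
  have h := Real.quadratic_le_exp_of_nonneg hx
  refine (inv_anti₀ (by positivity) h).trans ?_
  rw [inv_le_iff_one_le_mul₀ (by positivity)]
  -- `(1 + x + x ^ 2 / 2) * (1 - x + x ^ 2 / 2) = 1 + x ^ 4 / 4`.
  nlinarith [sq_nonneg (x ^ 2)]

/-- For the lower tail a second-order expansion suffices: the mean is exactly 1, and the second
moment is at most 4 by the exponential moment at `1 / 2`. -/
lemma integral_exp_neg_sq_norm_row_le {N : ℕ} (hN : 1 ≤ N) {y : Fin N → ℂ}
    (hy : ∑ n, ‖y n‖ ^ 2 = 1) {t : ℝ} (ht : 0 ≤ t) :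
    ∫ r, Real.exp (-t * (N * ‖r ⬝ᵥ y‖ ^ 2)) ∂rowLaw N ≤ Real.exp (-t + 2 * t ^ 2) := by
  have hc := continuous_dotProduct_left y
  set S : (Fin N → ℂ) → ℝ := fun r => N * ‖r ⬝ᵥ y‖ ^ 2 with hS
  have hSc : Continuous S := by simp only [hS]; fun_prop
  have hS0 : ∀ r, 0 ≤ S r := fun r => by positivity
  have hmean : ∫ r, S r ∂rowLaw N = 1 := integral_sq_norm_row hN hy
  have hmgf : ∫ r, Real.exp (1 / 2 * S r) ∂rowLaw N ≤ (1 - 1 / 2)⁻¹ :=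
    integral_exp_sq_norm_row_le hN hy (by norm_num) (by norm_num)
  change ∫ r, Real.exp (-t * S r) ∂rowLaw N ≤ _
  clear_value S
  -- From `1 + 1 / 2 + E[S ^ 2] / 8 ≤ E[exp (S / 2)] ≤ 2`.
  have hfour : ∫ r, S r ^ 2 ∂rowLaw N ≤ 4 := by
    have h2 : ∫ r, (1 + 1 / 2 * S r + 1 / 8 * S r ^ 2) ∂rowLaw N ≤
        ∫ r, Real.exp (1 / 2 * S r) ∂rowLaw N := by
      refine integral_mono (integrable_rowLaw (by fun_prop)) (integrable_rowLaw (by fun_prop))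
        fun r => ?_
      have := Real.quadratic_le_exp_of_nonneg (x := 1 / 2 * S r) (by linarith [hS0 r])
      simp only
      linarith
    rw [integral_add (integrable_rowLaw (by fun_prop)) (integrable_rowLaw (by fun_prop)),
      integral_add (integrable_rowLaw (by fun_prop)) (integrable_rowLaw (by fun_prop)),
      integral_const_mul, integral_const_mul, hmean] at h2
    simp only [integral_const, probReal_univ, smul_eq_mul] at h2
    norm_num at hmgf
    linarith
  have h3 : ∫ r, Real.exp (-t * S r) ∂rowLaw N ≤
      ∫ r, (1 - t * S r + t ^ 2 / 2 * S r ^ 2) ∂rowLaw N := by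
    refine integral_mono (integrable_rowLaw (by fun_prop)) (integrable_rowLaw (by fun_prop))
      fun r => ?_
    have := exp_neg_le_quadratic (mul_nonneg ht (hS0 r))
    simp only [neg_mul]
    linarith
  rw [integral_add (integrable_rowLaw (by fun_prop)) (integrable_rowLaw (by fun_prop)),
    integral_sub (integrable_rowLaw (by fun_prop)) (integrable_rowLaw (by fun_prop)),
    integral_const_mul, integral_const_mul, hmean] at h3
  simp only [integral_const, probReal_univ, smul_eq_mul] at h3
  have h4 : t ^ 2 / 2 * ∫ r, S r ^ 2 ∂rowLaw N ≤ t ^ 2 / 2 * 4 :=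
    mul_le_mul_of_nonneg_left hfour (by positivity)
  have h5 := Real.add_one_le_exp (-t + 2 * t ^ 2)
  linarith

/-! ### Chernoff bounds for a fixed vector -/

/-- The squared norm of the measurements of `y`, normalized. -/
def energy {M N : ℕ} (y : Fin N → ℂ) (A : Fin M → Fin N → ℂ) : ℝ := ∑ i, N * ‖A i ⬝ᵥ y‖ ^ 2

lemma continuous_energy {M N : ℕ} (y : Fin N → ℂ) :
    Continuous (energy y : (Fin M → Fin N → ℂ) → ℝ) := by
  unfold energy dotProduct; fun_prop

lemma mgf_energy {M N : ℕ} (y : Fin N → ℂ) (t : ℝ) :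
    mgf (energy y) (matrixLaw M N) t =
      (∫ r, Real.exp (t * (N * ‖r ⬝ᵥ y‖ ^ 2)) ∂rowLaw N) ^ M := by
  have h : ∀ A : Fin M → Fin N → ℂ, Real.exp (t * energy y A) =
      ∏ i, Real.exp (t * (N * ‖A i ⬝ᵥ y‖ ^ 2)) := by
    intro A
    rw [energy, Finset.mul_sum, Real.exp_sum]
  simp_rw [mgf, h]
  rw [matrixLaw, integral_fintype_prod_eq_prod
    (fun _ r => Real.exp (t * (N * ‖r ⬝ᵥ y‖ ^ 2)))]
  simp

lemma measure_energy_ge_le {M N : ℕ} (hN : 1 ≤ N) {y : Fin N → ℂ}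
    (hy : ∑ n, ‖y n‖ ^ 2 = 1) {e : ℝ} (he : 0 ≤ e) :
    (matrixLaw M N).real {A | M * (1 + e) ^ 2 ≤ energy y A} ≤ Real.exp (-(M * e ^ 2)) := by
  -- The minimizer of the Chernoff exponent; then `(1 - t)⁻¹ = (1 + e) ^ 2 ≤ exp (2 * e)`, leaving
  -- `-((1 + e) ^ 2 - 1) + 2 * e = -e ^ 2` per row.
  set t : ℝ := 1 - ((1 + e) ^ 2)⁻¹ with ht
  have hpos : (0 : ℝ) < (1 + e) ^ 2 := by positivity
  have ht0 : 0 ≤ t := by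
    rw [ht, sub_nonneg]
    exact inv_le_one_of_one_le₀ (by nlinarith)
  have ht1 : t < 1 := by rw [ht]; linarith [inv_pos.2 hpos]
  have hmgf : mgf (energy y) (matrixLaw M N) t ≤ Real.exp (M * (2 * e)) := by
    rw [mgf_energy]
    have h1 := integral_exp_sq_norm_row_le hN hy ht0 ht1
    have h2 : (1 - t)⁻¹ ≤ Real.exp (2 * e) := by
      rw [ht, sub_sub_cancel, inv_inv, two_mul, Real.exp_add, ← sq]
      exact pow_le_pow_left₀ (by linarith) (by linarith [Real.add_one_le_exp e]) 2
    rw [Real.exp_nat_mul]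
    exact pow_le_pow_left₀ (integral_nonneg fun _ => (Real.exp_pos _).le) (h1.trans h2) M
  have hch := measure_ge_le_exp_mul_mgf (μ := matrixLaw M N) (X := energy y) (M * (1 + e) ^ 2) ht0
    (integrable_matrixLaw (by have := continuous_energy (M := M) y; fun_prop))
  refine hch.trans ((mul_le_mul_of_nonneg_left hmgf (Real.exp_pos _).le).trans_eq ?_)
  rw [← Real.exp_add]
  congr 1
  rw [ht]
  field_simp
  ring

lemma measure_energy_le_le {M N : ℕ} (hN : 1 ≤ N) {y : Fin N → ℂ}
    (hy : ∑ n, ‖y n‖ ^ 2 = 1) {e : ℝ} (he : 0 ≤ e) (he1 : e ≤ 1) :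
    (matrixLaw M N).real {A | energy y A ≤ M * (1 - e) ^ 2} ≤ Real.exp (-(M * e ^ 2 / 8)) := by
  have ht0 : -(e / 4) ≤ 0 := by linarith
  have hmgf : mgf (energy y) (matrixLaw M N) (-(e / 4)) ≤
      Real.exp (M * (-(e / 4) + 2 * (e / 4) ^ 2)) := by
    rw [mgf_energy, Real.exp_nat_mul]
    exact pow_le_pow_left₀ (integral_nonneg fun _ => (Real.exp_pos _).le)
      (integral_exp_neg_sq_norm_row_le hN hy (by linarith)) M
  have hch := measure_le_le_exp_mul_mgf (μ := matrixLaw M N) (X := energy y) (M * (1 - e) ^ 2) ht0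
    (integrable_matrixLaw (by have := continuous_energy (M := M) y; fun_prop))
  refine hch.trans ((mul_le_mul_of_nonneg_left hmgf (Real.exp_pos _).le).trans ?_)
  rw [← Real.exp_add]
  refine Real.exp_le_exp.2 ?_
  -- At parameter `-e / 4` the exponent per row is `-3 * e ^ 2 / 8 + e ^ 3 / 4`, at most `-e ^ 2 /
  -- 8` because `e ≤ 1`.
  have : (M : ℝ) * (e / 4 * (1 - e) ^ 2 + (-(e / 4) + 2 * (e / 4) ^ 2)) ≤ M * (-(e ^ 2 / 8)) := by
    refine mul_le_mul_of_nonneg_left ?_ (Nat.cast_nonneg M)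
    nlinarith [mul_nonneg he (mul_nonneg he (sub_nonneg.2 he1))]
  linarith

/-! ### Euclidean norms and the single-vector tail bound -/

lemma euclNorm_sq {n : ℕ} (v : Fin n → ℂ) : euclNorm v ^ 2 = ∑ i, ‖v i‖ ^ 2 := by
  rw [euclNorm, EuclideanSpace.norm_sq_eq]

lemma euclNorm_nonneg {n : ℕ} (v : Fin n → ℂ) : 0 ≤ euclNorm v := norm_nonneg _

lemma euclNorm_add_le {n : ℕ} (v w : Fin n → ℂ) : euclNorm (v + w) ≤ euclNorm v + euclNorm w :=
  norm_add_le (WithLp.toLp 2 v) (WithLp.toLp 2 w)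

lemma euclNorm_sub_comm {n : ℕ} (v w : Fin n → ℂ) : euclNorm (v - w) = euclNorm (w - v) :=
  norm_sub_rev (WithLp.toLp 2 v) (WithLp.toLp 2 w)

lemma euclNorm_smul {n : ℕ} (c : ℂ) (v : Fin n → ℂ) : euclNorm (c • v) = ‖c‖ * euclNorm v :=
  norm_smul c (WithLp.toLp 2 v)

lemma euclNorm_sum_le {n : ℕ} {ι : Type*} (s : Finset ι) (v : ι → Fin n → ℂ) :
    euclNorm (∑ i ∈ s, v i) ≤ ∑ i ∈ s, euclNorm (v i) := by
  simpa [euclNorm, WithLp.toLp_sum] using norm_sum_le s fun i => WithLp.toLp 2 (v i)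

lemma euclNorm_eq_zero {n : ℕ} {v : Fin n → ℂ} : euclNorm v = 0 ↔ v = 0 := by
  rw [euclNorm, norm_eq_zero, WithLp.toLp_eq_zero]

lemma euclNorm_pos {n : ℕ} {v : Fin n → ℂ} (hv : v ≠ 0) : 0 < euclNorm v :=
  (euclNorm_nonneg v).lt_of_ne fun h => hv (euclNorm_eq_zero.1 h.symm)

/-- The norm of the measurements of `y`, scaled to match the norm of `y` on average. -/
def scaledNorm {M N : ℕ} (A : Matrix (Fin M) (Fin N) ℂ) (y : Fin N → ℂ) : ℝ :=
  √((N : ℝ) / M) * euclNorm (A.mulVec y)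

lemma scaledNorm_nonneg {M N : ℕ} (A : Matrix (Fin M) (Fin N) ℂ) (y : Fin N → ℂ) :
    0 ≤ scaledNorm A y := mul_nonneg (Real.sqrt_nonneg _) (euclNorm_nonneg _)

lemma scaledNorm_smul {M N : ℕ} (A : Matrix (Fin M) (Fin N) ℂ) (c : ℂ) (y : Fin N → ℂ) :
    scaledNorm A (c • y) = ‖c‖ * scaledNorm A y := by
  rw [scaledNorm, scaledNorm, Matrix.mulVec_smul, euclNorm_smul]; ring

lemma scaledNorm_add_le {M N : ℕ} (A : Matrix (Fin M) (Fin N) ℂ) (y z : Fin N → ℂ) :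
    scaledNorm A (y + z) ≤ scaledNorm A y + scaledNorm A z := by
  rw [scaledNorm, scaledNorm, scaledNorm, Matrix.mulVec_add, ← mul_add]
  exact mul_le_mul_of_nonneg_left (euclNorm_add_le _ _) (Real.sqrt_nonneg _)

lemma mul_scaledNorm_sq {M N : ℕ} (hM : 1 ≤ M) (A : Fin M → Fin N → ℂ) (y : Fin N → ℂ) :
    M * scaledNorm (Matrix.of A) y ^ 2 = energy y A := by
  have hM0 : (M : ℝ) ≠ 0 := by positivity
  rw [scaledNorm, mul_pow, Real.sq_sqrt (by positivity), euclNorm_sq, energy, ← Finset.mul_sum]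
  simp only [Matrix.mulVec, Matrix.of_apply]
  field_simp

/-- Cauchy–Schwarz in each row: all weights have modulus `1 / √N`, so every row is a unit vector. -/
lemma scaledNorm_le_of_mem_weightValues {M N : ℕ} (hM : 1 ≤ M) (hN : 1 ≤ N)
    {A : Matrix (Fin M) (Fin N) ℂ} (hA : ∀ i n, A i n ∈ weightValues N) (y : Fin N → ℂ) :
    scaledNorm A y ≤ √(N : ℝ) * euclNorm y := by
  have hM0 : (0 : ℝ) < M := by exact_mod_cast hM
  have hN0 : (0 : ℝ) < N := by exact_mod_cast hN
  have hrow : ∀ i, ‖A i ⬝ᵥ y‖ ^ 2 ≤ euclNorm y ^ 2 := by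
    intro i
    have h1 : ‖A i ⬝ᵥ y‖ ≤ ∑ n, ‖A i n‖ * ‖y n‖ := by
      refine (norm_sum_le _ _).trans_eq ?_
      simp
    calc ‖A i ⬝ᵥ y‖ ^ 2 ≤ (∑ n, ‖A i n‖ * ‖y n‖) ^ 2 :=
          pow_le_pow_left₀ (norm_nonneg _) h1 2
      _ ≤ (∑ n, ‖A i n‖ ^ 2) * ∑ n, ‖y n‖ ^ 2 := Finset.sum_mul_sq_le_sq_mul_sq _ _ _
      _ = euclNorm y ^ 2 := by
          simp_rw [fun n => sq_norm_of_mem_weightValues (hA i n), euclNorm_sq]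
          simp [hN0.ne']
  have h2 : euclNorm (A.mulVec y) ^ 2 ≤ M * euclNorm y ^ 2 := by
    rw [euclNorm_sq]
    refine (Finset.sum_le_sum fun i _ => hrow i).trans_eq ?_
    simp
  refine abs_le_of_sq_le_sq' ?_ (mul_nonneg (Real.sqrt_nonneg _) (euclNorm_nonneg _)) |>.2
  rw [scaledNorm, mul_pow, mul_pow, Real.sq_sqrt (by positivity), Real.sq_sqrt hN0.le]
  calc (N : ℝ) / M * euclNorm (A.mulVec y) ^ 2 ≤ N / M * (M * euclNorm y ^ 2) := by gcongr
    _ = _ := by field_simp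

/-- The two-sided tail bound for a single vector. -/
lemma matrixLaw_not_near_isometry_le {M N : ℕ} (hM : 1 ≤ M) (hN : 1 ≤ N) (y : Fin N → ℂ) {e : ℝ}
    (he : 0 < e) :
    matrixLaw M N {A | ¬ ((1 - e) * euclNorm y ≤ scaledNorm (Matrix.of A) y ∧
        scaledNorm (Matrix.of A) y ≤ (1 + e) * euclNorm y)} ≤
      ENNReal.ofReal (2 * Real.exp (-(M * e ^ 2 / 8))) := by
  have hM0 : (0 : ℝ) < M := by exact_mod_cast hM
  rcases eq_or_ne y 0 with rfl | hy0
  · have : ∀ A : Fin M → Fin N → ℂ, scaledNorm (Matrix.of A) 0 = 0 := fun A => by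
      simp [scaledNorm, euclNorm]
    simp [this, euclNorm_eq_zero.2 (rfl : (0 : Fin N → ℂ) = 0)]
  have hpos := euclNorm_pos hy0
  set u : Fin N → ℂ := ((euclNorm y)⁻¹ : ℂ) • y with hu
  have hyu : y = (euclNorm y : ℂ) • u := by
    rw [hu, smul_smul, mul_inv_cancel₀ (by exact_mod_cast hpos.ne'), one_smul]
  have hun : ∑ n, ‖u n‖ ^ 2 = 1 := by
    rw [← euclNorm_sq, hu, euclNorm_smul, norm_inv, Complex.norm_real, Real.norm_eq_abs,
      abs_of_pos hpos, inv_mul_cancel₀ hpos.ne', one_pow]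
  have hsc : ∀ A : Fin M → Fin N → ℂ,
      scaledNorm (Matrix.of A) y = euclNorm y * scaledNorm (Matrix.of A) u := by
    intro A
    conv_lhs => rw [hyu]
    rw [scaledNorm_smul, Complex.norm_real, Real.norm_eq_abs, abs_of_pos hpos]
  -- Failure from below forces `e < 1`, since scaled norms are nonnegative; this supplies the
  -- hypothesis of the lower tail bound.
  have hsub : {A : Fin M → Fin N → ℂ | ¬ ((1 - e) * euclNorm y ≤ scaledNorm (Matrix.of A) y ∧
        scaledNorm (Matrix.of A) y ≤ (1 + e) * euclNorm y)} ⊆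
      {A | M * (1 + e) ^ 2 ≤ energy u A} ∪
        {A | e ≤ 1 ∧ energy u A ≤ M * (1 - e) ^ 2} := by
    intro A hA
    simp only [Set.mem_ofPred_eq, hsc, not_and_or, not_le] at hA
    simp only [Set.mem_union, Set.mem_ofPred_eq, ← mul_scaledNorm_sq hM]
    have h0 := scaledNorm_nonneg (Matrix.of A) u
    rcases hA with h | h
    · right
      have h1 : scaledNorm (Matrix.of A) u < 1 - e := by
        rw [mul_comm] at h; exact lt_of_mul_lt_mul_right h hpos.le
      exact ⟨by linarith, by gcongr⟩
    · left
      have h1 : 1 + e < scaledNorm (Matrix.of A) u := by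
        rw [mul_comm (euclNorm y)] at h; exact lt_of_mul_lt_mul_right h hpos.le
      gcongr
  refine (measure_mono hsub).trans ((measure_union_le _ _).trans ?_)
  rw [two_mul, ENNReal.ofReal_add (Real.exp_pos _).le (Real.exp_pos _).le]
  refine add_le_add ?_ ?_
  · rw [← ofReal_measureReal]
    refine ENNReal.ofReal_le_ofReal ((measure_energy_ge_le hN hun he.le).trans ?_)
    refine Real.exp_le_exp.2 ?_
    have : 0 ≤ (M : ℝ) * e ^ 2 := by positivity
    linarith
  · by_cases h1 : e ≤ 1
    · simp only [h1, true_and]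
      rw [← ofReal_measureReal]
      exact ENNReal.ofReal_le_ofReal (measure_energy_le_le hN hun he.le h1)
    · simp [h1]

/-! ### Transfer to an arbitrary probability space -/

/-- The law of a random measurement matrix is the product law. -/
lemma IsRandomMeasurementMatrix.map_eq {Ω : Type*} [MeasurableSpace Ω] {P : Measure Ω}
    {M N : ℕ} {A : Ω → Matrix (Fin M) (Fin N) ℂ} (hA : IsRandomMeasurementMatrix P A) :
    P.map (fun x p => A x (Prod.fst p) (Prod.snd p)) =
      (matrixLaw M N).map fun (B : Fin M → Fin N → ℂ) (p : Fin M × Fin N) => B p.1 p.2 := by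
  refine (hA.indep.map_fun_eq_pi_map fun p : Fin M × Fin N => (hA.law p.1 p.2).aemeasurable).trans ?_
  simp_rw [fun p : Fin M × Fin N => (hA.law p.1 p.2).map_eq]
  refine Measure.pi_eq fun s hs => ?_
  rw [Measure.map_apply (by fun_prop) (MeasurableSet.univ_pi hs)]
  have : (fun (B : Fin M → Fin N → ℂ) (p : Fin M × Fin N) => B p.1 p.2) ⁻¹' Set.univ.pi s =
      Set.univ.pi fun i => Set.univ.pi fun n => s (i, n) := by
    ext B; simp
  rw [this, matrixLaw, Measure.pi_pi]
  simp_rw [rowLaw, Measure.pi_pi]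
  rw [Fintype.prod_prod_type]

/-- No measurability of `p` is required, which matters because the isometry event quantifies over
uncountably many mixtures. The inequality `Measure.le_map_apply` holds for all sets, and the final
reindexing is a measurable equivalence, for which pushforward is exact on all sets. -/
lemma IsRandomMeasurementMatrix.measure_le {Ω : Type*} [MeasurableSpace Ω] {P : Measure Ω}
    {M N : ℕ} {A : Ω → Matrix (Fin M) (Fin N) ℂ} (hA : IsRandomMeasurementMatrix P A)
    (p : Matrix (Fin M) (Fin N) ℂ → Prop) :
    P {x | p (A x)} ≤ matrixLaw M N {B | p (Matrix.of B)} := by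
  have hmeas : AEMeasurable (fun x (q : Fin M × Fin N) => A x q.1 q.2) P :=
    aemeasurable_pi_lambda _ fun q => (hA.law q.1 q.2).aemeasurable
  have h := Measure.le_map_apply hmeas {B | p (Matrix.of fun i n => B (i, n))}
  refine h.trans_eq ?_
  rw [hA.map_eq]
  exact (MeasurableEquiv.curry (Fin M) (Fin N) ℂ).symm.map_apply _

/-! ### Nets of sinusoids and mixtures -/

lemma sinusoid_eq {N : ℕ} (h : Fin N → ℂ) (w : ℝ) (n : Fin N) :
    sinusoid h w n = h n * Complex.exp (Complex.I * ((w * ((n : ℝ) - ((N : ℝ) - 1) / 2) : ℝ) : ℂ)) := by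
  rw [sinusoid]; push_cast; rw [mul_assoc]

lemma norm_sinusoid {N : ℕ} (h : Fin N → ℂ) (w : ℝ) (n : Fin N) : ‖sinusoid h w n‖ = ‖h n‖ := by
  rw [sinusoid_eq, norm_mul, Complex.norm_exp_I_mul_ofReal, mul_one]

lemma euclNorm_sinusoid {N : ℕ} {h : Fin N → ℂ} (hh : ∑ n, ‖h n‖ ^ 2 = 1) (w : ℝ) :
    euclNorm (sinusoid h w) = 1 := by
  refine (sq_eq_sq₀ (euclNorm_nonneg _) zero_le_one).1 ?_
  rw [euclNorm_sq]
  simpa [norm_sinusoid] using hh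

/-- Entrywise, `|exp (j x) - 1| ≤ |x|` with centred indices of size at most `N`; the unit norm of
the window then sums the errors. -/
lemma euclNorm_sinusoid_sub_le {N : ℕ} {h : Fin N → ℂ} (hh : ∑ n, ‖h n‖ ^ 2 = 1) (w w' : ℝ) :
    euclNorm (sinusoid h w - sinusoid h w') ≤ N * |w - w'| := by
  refine abs_le_of_sq_le_sq' ?_ (by positivity) |>.2
  rw [euclNorm_sq]
  have hterm : ∀ n : Fin N, ‖(sinusoid h w - sinusoid h w') n‖ ≤ ‖h n‖ * (N * |w - w'|) := by
    intro n
    set p : ℝ := (n : ℝ) - ((N : ℝ) - 1) / 2 with hp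
    have hpN : |p| ≤ N := by
      have h1 : (n : ℝ) + 1 ≤ N := by exact_mod_cast n.2
      have h0 : (0 : ℝ) ≤ n := Nat.cast_nonneg _
      rw [abs_le]
      constructor <;> simp only [hp] <;> linarith
    have hsplit : (sinusoid h w - sinusoid h w') n =
        h n * (Complex.exp (Complex.I * ((w' * p : ℝ) : ℂ)) *
          (Complex.exp (Complex.I * (((w - w') * p : ℝ) : ℂ)) - 1)) := by
      rw [Pi.sub_apply, sinusoid_eq, sinusoid_eq, ← mul_sub, ← hp, mul_sub (Complex.exp _),
        mul_one, ← Complex.exp_add]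
      congr 3
      push_cast
      ring
    rw [hsplit, norm_mul, norm_mul, Complex.norm_exp_I_mul_ofReal, one_mul]
    refine mul_le_mul_of_nonneg_left ?_ (norm_nonneg _)
    refine (Real.norm_exp_I_mul_ofReal_sub_one_le).trans ?_
    rw [Real.norm_eq_abs, abs_mul, mul_comm]
    exact mul_le_mul_of_nonneg_right hpN (abs_nonneg _)
  calc _ ≤ ∑ n, (‖h n‖ * (N * |w - w'|)) ^ 2 :=
        Finset.sum_le_sum fun n _ => pow_le_pow_left₀ (norm_nonneg _) (hterm n) 2
    _ = _ := by simp_rw [mul_pow _ _ 2]; rw [← Finset.sum_mul, hh, one_mul]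

/-- Up to a phase, a sinusoid depends only on its frequency modulo `2 * π`. -/
lemma exists_sinusoid_eq_smul {N : ℕ} (h : Fin N → ℂ) (w : ℝ) :
    ∃ (s : ℂ) (w' : ℝ), ‖s‖ = 1 ∧ 0 ≤ w' ∧ w' < 2 * Real.pi ∧
      sinusoid h w = s • sinusoid h w' := by
  have hpi := Real.two_pi_pos
  set k : ℤ := ⌊w / (2 * Real.pi)⌋ with hk
  have h1 : (k : ℝ) * (2 * Real.pi) ≤ w := (le_div_iff₀ hpi).1 (Int.floor_le _)
  have h2 : w < ((k : ℝ) + 1) * (2 * Real.pi) := (div_lt_iff₀ hpi).1 (Int.lt_floor_add_one _)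
  -- A shift by `2 * π * k` changes entry `n` by `exp (2 * π * j * k * n) = 1` times a centring
  -- phase independent of `n`.
  refine ⟨Complex.exp (Complex.I * ((-(k * (2 * Real.pi) * (((N : ℝ) - 1) / 2)) : ℝ) : ℂ)),
    w - k * (2 * Real.pi), Complex.norm_exp_I_mul_ofReal _, by linarith, by linarith, ?_⟩
  ext n
  rw [Pi.smul_apply, smul_eq_mul, sinusoid_eq, sinusoid_eq, mul_left_comm, ← Complex.exp_add]
  congr 1
  rw [Complex.exp_eq_exp_iff_exists_int]
  refine ⟨k * n, ?_⟩
  push_cast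
  ring

/-- A finite net for the multiples `g • sinusoid h w` with `‖g‖ ≤ D`. -/
def atomNet {N : ℕ} (h : Fin N → ℂ) (D L : ℕ) : Finset (Fin N → ℂ) :=
  ((Finset.range (7 * L)) ×ˢ (Finset.Icc (-((D * L : ℕ) : ℤ)) ((D * L : ℕ) : ℤ)) ×ˢ
    (Finset.Icc (-((D * L : ℕ) : ℤ)) ((D * L : ℕ) : ℤ))).image
      fun q => (⟨(q.2.1 : ℝ) / L, (q.2.2 : ℝ) / L⟩ : ℂ) • sinusoid h ((q.1 : ℝ) / L)

lemma card_atomNet_le {N : ℕ} (h : Fin N → ℂ) (D L : ℕ) :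
    (atomNet h D L).card ≤ 7 * L * (2 * (D * L) + 1) ^ 2 := by
  refine Finset.card_image_le.trans_eq ?_
  rw [Finset.card_product, Finset.card_product, Finset.card_range, Int.card_Icc]
  have : ((D * L : ℕ) + 1 - -((D * L : ℕ) : ℤ)).toNat = 2 * (D * L) + 1 := by omega
  rw [this, sq]

lemma floor_mul_mem_Icc {D L : ℕ} {x : ℝ} (hx : |x| ≤ D) :
    ⌊x * L⌋ ∈ Finset.Icc (-((D * L : ℕ) : ℤ)) ((D * L : ℕ) : ℤ) := by
  have hL : (0 : ℝ) ≤ L := Nat.cast_nonneg _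
  obtain ⟨h1, h2⟩ := abs_le.1 hx
  rw [Finset.mem_Icc]
  constructor
  · rw [Int.le_floor]
    push_cast
    nlinarith
  · have : (⌊x * L⌋ : ℝ) ≤ ((D * L : ℕ) : ℤ) := by
      refine (Int.floor_le _).trans ?_
      push_cast
      nlinarith
    exact_mod_cast this

lemma abs_sub_floor_mul_div_le {L : ℕ} (hL : 1 ≤ L) (x : ℝ) : |x - ⌊x * L⌋ / L| ≤ 1 / L := by
  have hL0 : (0 : ℝ) < L := by exact_mod_cast hL
  have h1 := Int.floor_le (x * L)
  have h2 := Int.lt_floor_add_one (x * L)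
  have h3 : x - ⌊x * L⌋ / L = (x * L - ⌊x * L⌋) / L := by field_simp
  rw [h3, abs_div, abs_of_pos hL0]
  gcongr
  rw [abs_le]
  constructor <;> linarith

/-- The phase from reducing the frequency is absorbed into the coefficient without changing its
modulus. Rounding the frequency costs `D * N / L` and rounding the coefficient `2 / L`. -/
lemma exists_mem_atomNet {N D L : ℕ} (hN : 1 ≤ N) (hD : 1 ≤ D) (hL : 1 ≤ L) {h : Fin N → ℂ}
    (hh : ∑ n, ‖h n‖ ^ 2 = 1) (w : ℝ) {g : ℂ} (hg : ‖g‖ ≤ D) :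
    ∃ a ∈ atomNet h D L, euclNorm (g • sinusoid h w - a) ≤ 3 * D * N / L := by
  have hL0 : (0 : ℝ) < L := by exact_mod_cast hL
  have hD0 : (1 : ℝ) ≤ D := by exact_mod_cast hD
  have hN0 : (1 : ℝ) ≤ N := by exact_mod_cast hN
  obtain ⟨s, w', hs, hw0, hw1, hw⟩ := exists_sinusoid_eq_smul h w
  set g' : ℂ := g * s with hg'
  have hg'n : ‖g'‖ ≤ D := by rw [hg', norm_mul, hs, mul_one]; exact hg
  have hgw : g • sinusoid h w = g' • sinusoid h w' := by rw [hw, smul_smul]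
  set γ : ℂ := ⟨(⌊g'.re * L⌋ : ℝ) / L, (⌊g'.im * L⌋ : ℝ) / L⟩ with hγ
  have hfl : ((⌊w' * L⌋₊ : ℕ) : ℝ) = (⌊w' * L⌋ : ℝ) := by
    exact natCast_floor_eq_intCast_floor (by positivity)
  refine ⟨γ • sinusoid h ((⌊w' * L⌋₊ : ℝ) / L), ?_, ?_⟩
  · refine Finset.mem_image.2 ⟨(⌊w' * L⌋₊, ⌊g'.re * L⌋, ⌊g'.im * L⌋), ?_, rfl⟩
    simp only [Finset.mem_product]
    refine ⟨?_, floor_mul_mem_Icc ((Complex.abs_re_le_norm _).trans hg'n),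
      floor_mul_mem_Icc ((Complex.abs_im_le_norm _).trans hg'n)⟩
    -- The range `7 * L` suffices because `2 * π < 7`.
    rw [Finset.mem_range, Nat.floor_lt (by positivity)]
    push_cast
    have := Real.pi_lt_d2
    nlinarith
  · have h1 : ‖g' - γ‖ ≤ 2 / L := by
      refine (Complex.norm_le_abs_re_add_abs_im _).trans ?_
      have h1 := abs_sub_floor_mul_div_le hL g'.re
      have h2 := abs_sub_floor_mul_div_le hL g'.im
      simp only [Complex.sub_re, Complex.sub_im, hγ]
      refine (add_le_add h1 h2).trans_eq ?_
      ring
    have h2 : |w' - (⌊w' * L⌋₊ : ℝ) / L| ≤ 1 / L := by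
      rw [hfl]; exact abs_sub_floor_mul_div_le hL w'
    set v : ℝ := (⌊w' * L⌋₊ : ℝ) / L
    have hsplit : g • sinusoid h w - γ • sinusoid h v =
        g' • (sinusoid h w' - sinusoid h v) + (g' - γ) • sinusoid h v := by
      rw [hgw, smul_sub, sub_smul]; abel
    rw [hsplit]
    refine (euclNorm_add_le _ _).trans ?_
    rw [euclNorm_smul, euclNorm_smul, euclNorm_sinusoid hh, mul_one]
    calc _ ≤ (D : ℝ) * (N * (1 / L)) + 2 / L := by
          refine add_le_add (mul_le_mul hg'n ?_ (euclNorm_nonneg _) (by positivity)) h1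
          exact (euclNorm_sinusoid_sub_le hh _ _).trans (by gcongr)
      _ = (D * N + 2) / L := by ring
      _ ≤ _ := by
          gcongr
          nlinarith

/-- A finite net for the mixtures of `K` sinusoids with coefficients of modulus at most `D`. -/
def mixtureNet {N : ℕ} (K : ℕ) (h : Fin N → ℂ) (D L : ℕ) : Finset (Fin N → ℂ) :=
  (Fintype.piFinset fun _ : Fin K => atomNet h D L).image fun a => ∑ l, a l

lemma card_mixtureNet_le {N : ℕ} (K : ℕ) (h : Fin N → ℂ) (D L : ℕ) :
    (mixtureNet K h D L).card ≤ (7 * L * (2 * (D * L) + 1) ^ 2) ^ K := by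
  refine Finset.card_image_le.trans ?_
  rw [Fintype.card_piFinset_const]
  exact Nat.pow_le_pow_left (card_atomNet_le h D L) K

lemma sinusoidMatrix_mulVec {N K : ℕ} (h : Fin N → ℂ) (w : Fin K → ℝ) (g : Fin K → ℂ) :
    (sinusoidMatrix h w).mulVec g = ∑ l, g l • sinusoid h (w l) := by
  ext n
  simp [sinusoidMatrix, Matrix.mulVec, dotProduct, mul_comm]

lemma exists_mem_mixtureNet {N K D L : ℕ} (hN : 1 ≤ N) (hD : 1 ≤ D) (hL : 1 ≤ L) {h : Fin N → ℂ}
    (hh : ∑ n, ‖h n‖ ^ 2 = 1) (w : Fin K → ℝ) {g : Fin K → ℂ} (hg : ∀ l, ‖g l‖ ≤ D) :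
    ∃ y ∈ mixtureNet K h D L,
      euclNorm ((sinusoidMatrix h w).mulVec g - y) ≤ K * (3 * D * N / L) := by
  choose a ha hga using fun l => exists_mem_atomNet hN hD hL hh (w l) (hg l)
  refine ⟨∑ l, a l, Finset.mem_image.2 ⟨a, Fintype.mem_piFinset.2 ha, rfl⟩, ?_⟩
  rw [sinusoidMatrix_mulVec, ← Finset.sum_sub_distrib]
  refine (euclNorm_sum_le _ _).trans ((Finset.sum_le_sum fun l _ => hga l).trans_eq ?_)
  simp

/-! ### From the net to all well-conditioned mixtures -/

lemma norm_le_euclNorm {n : ℕ} (v : Fin n → ℂ) (i : Fin n) : ‖v i‖ ≤ euclNorm v :=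
  PiLp.norm_apply_le (WithLp.toLp 2 v) i

lemma mul_euclNorm_le_of_mem_wellConditioned {N K : ℕ} {h : Fin N → ℂ} {δ : ℝ} {w : Fin K → ℝ}
    (hw : w ∈ wellConditioned K h δ) {g : Fin K → ℂ} (hg : g ≠ 0) :
    δ * euclNorm g ≤ euclNorm ((sinusoidMatrix h w).mulVec g) := by
  rw [← le_div_iff₀ (euclNorm_pos hg)]
  refine le_trans hw (ciInf_le (f := fun g : {g : Fin K → ℂ // g ≠ 0} =>
    euclNorm ((sinusoidMatrix h w).mulVec g.1) / euclNorm g.1) ⟨0, ?_⟩ ⟨g, hg⟩)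
  rintro _ ⟨g, rfl⟩
  exact div_nonneg (euclNorm_nonneg _) (euclNorm_nonneg _)

/-- The columns are unit vectors, so testing on a basis vector bounds the smallest singular value by
1. -/
lemma le_one_of_mem_wellConditioned {N K : ℕ} (hK : 1 ≤ K) {h : Fin N → ℂ}
    (hh : ∑ n, ‖h n‖ ^ 2 = 1) {δ : ℝ} {w : Fin K → ℝ} (hw : w ∈ wellConditioned K h δ) :
    δ ≤ 1 := by
  have l : Fin K := ⟨0, hK⟩
  have hne : (Pi.single l 1 : Fin K → ℂ) ≠ 0 := by simp
  have h1 := mul_euclNorm_le_of_mem_wellConditioned hw hne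
  have h2 : euclNorm (Pi.single l 1 : Fin K → ℂ) = 1 := by simp [euclNorm]
  have h3 : (sinusoidMatrix h w).mulVec (Pi.single l 1) = sinusoid h (w l) := by
    ext n; simp [sinusoidMatrix]
  rwa [h3, h2, euclNorm_sinusoid hh, mul_one] at h1

/-- Every mixture reduces to one of unit norm with coefficients of modulus at most `δ⁻¹`. -/
lemma isMixtureIsometry_of_unit {M N K : ℕ} {h : Fin N → ℂ} {δ ε : ℝ} (hδ : 0 < δ)
    {A : Matrix (Fin M) (Fin N) ℂ}
    (H : ∀ (w : Fin K → ℝ) (g : Fin K → ℂ), w ∈ wellConditioned K h δ → (∀ l, ‖g l‖ ≤ δ⁻¹) →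
      euclNorm ((sinusoidMatrix h w).mulVec g) = 1 →
      1 - ε ≤ scaledNorm A ((sinusoidMatrix h w).mulVec g) ∧
        scaledNorm A ((sinusoidMatrix h w).mulVec g) ≤ 1 + ε) :
    IsMixtureIsometry K h δ ε A := by
  intro w hw g hg
  have hle := mul_euclNorm_le_of_mem_wellConditioned hw hg
  have hpos : 0 < euclNorm ((sinusoidMatrix h w).mulVec g) :=
    (mul_pos hδ (euclNorm_pos hg)).trans_le hle
  set z := (sinusoidMatrix h w).mulVec g
  have hc : ‖((euclNorm z)⁻¹ : ℂ)‖ = (euclNorm z)⁻¹ := by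
    rw [norm_inv, Complex.norm_real, Real.norm_eq_abs, abs_of_pos hpos]
  have hz : (sinusoidMatrix h w).mulVec (((euclNorm z)⁻¹ : ℂ) • g) = ((euclNorm z)⁻¹ : ℂ) • z :=
    Matrix.mulVec_smul _ _ _
  have hsc : √((N : ℝ) / M) * (euclNorm (A.mulVec z) / euclNorm z) =
      scaledNorm A (((euclNorm z)⁻¹ : ℂ) • z) := by
    rw [scaledNorm_smul, hc, scaledNorm]; ring
  rw [hsc, ← hz]
  refine H w _ hw (fun l => ?_) ?_
  -- Conditioning gives `δ * ‖g l‖ ≤ δ * ‖g‖ ≤ ‖X g‖`.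
  · rw [Pi.smul_apply, smul_eq_mul, norm_mul, hc, inv_mul_le_iff₀ hpos, ← div_eq_mul_inv,
      le_div_iff₀ hδ, mul_comm]
    exact (mul_le_mul_of_nonneg_left (norm_le_euclNorm g l) hδ.le).trans hle
  · rw [hz, euclNorm_smul, hc, inv_mul_cancel₀ hpos.ne']

/-- For `ε ≥ √N ≥ 1` the lower bound is trivial and the upper one follows from the deterministic
estimate. -/
lemma isMixtureIsometry_of_sqrt_le {M N K : ℕ} (hM : 1 ≤ M) (hN : 1 ≤ N) {h : Fin N → ℂ} {δ ε : ℝ}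
    (hδ : 0 < δ) (hε : √(N : ℝ) ≤ ε) {A : Matrix (Fin M) (Fin N) ℂ}
    (hA : ∀ i n, A i n ∈ weightValues N) : IsMixtureIsometry K h δ ε A := by
  refine isMixtureIsometry_of_unit hδ fun w g _ _ hz => ?_
  have h1 := scaledNorm_le_of_mem_weightValues hM hN hA ((sinusoidMatrix h w).mulVec g)
  have h2 : 1 ≤ √(N : ℝ) := Real.one_le_sqrt.2 (by exact_mod_cast hN)
  have h3 := scaledNorm_nonneg A ((sinusoidMatrix h w).mulVec g)
  rw [hz, mul_one] at h1
  constructor <;> linarith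

lemma isMixtureIsometry_of_net {M N K D L : ℕ} (hM : 1 ≤ M) (hN : 1 ≤ N) (hD : 1 ≤ D) (hL : 1 ≤ L)
    {h : Fin N → ℂ} (hh : ∑ n, ‖h n‖ ^ 2 = 1) {δ ε : ℝ} (hδ : 0 < δ) (hδD : δ⁻¹ ≤ D)
    (hε : 0 < ε) (hεN : ε ≤ √(N : ℝ)) (hmesh : K * (3 * D * N / L) ≤ ε / (8 * √(N : ℝ)))
    {A : Matrix (Fin M) (Fin N) ℂ} (hA : ∀ i n, A i n ∈ weightValues N)
    (hnet : ∀ y ∈ mixtureNet K h D L, (1 - ε / 2) * euclNorm y ≤ scaledNorm A y ∧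
      scaledNorm A y ≤ (1 + ε / 2) * euclNorm y) :
    IsMixtureIsometry K h δ ε A := by
  refine isMixtureIsometry_of_unit hδ fun w g _ hg hz => ?_
  obtain ⟨y, hy, hzy⟩ := exists_mem_mixtureNet hN hD hL hh w fun l => (hg l).trans hδD
  set z := (sinusoidMatrix h w).mulVec g
  have hs : 1 ≤ √(N : ℝ) := Real.one_le_sqrt.2 (by exact_mod_cast hN)
  set η : ℝ := ε / (8 * √(N : ℝ)) with hη
  have hη0 : 0 ≤ η := by positivity
  have hsη : √(N : ℝ) * η = ε / 8 := by rw [hη]; field_simp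
  have hη8 : η ≤ ε / 8 := by nlinarith
  -- Uses `ε ≤ √N`, that is, `η ≤ 1 / 8`; it controls the cross term in the upper bound.
  have hεη : ε * η ≤ ε / 8 := by nlinarith
  have hd : euclNorm (z - y) ≤ η := hzy.trans hmesh
  have hd' : euclNorm (y - z) ≤ η := by rwa [euclNorm_sub_comm]
  have hAd : scaledNorm A (z - y) ≤ ε / 8 :=
    (scaledNorm_le_of_mem_weightValues hM hN hA _).trans
      ((mul_le_mul_of_nonneg_left hd (Real.sqrt_nonneg _)).trans_eq hsη)
  have hAd' : scaledNorm A (y - z) ≤ ε / 8 :=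
    (scaledNorm_le_of_mem_weightValues hM hN hA _).trans
      ((mul_le_mul_of_nonneg_left hd' (Real.sqrt_nonneg _)).trans_eq hsη)
  have e1 := euclNorm_add_le (y - z) z
  have e2 := euclNorm_add_le (z - y) y
  have s1 := scaledNorm_add_le A (y - z) z
  have s2 := scaledNorm_add_le A (z - y) y
  rw [sub_add_cancel] at e1 e2 s1 s2
  obtain ⟨n1, n2⟩ := hnet y hy
  rw [hz] at e1 e2
  have hA0 := scaledNorm_nonneg A z
  constructor
  -- The first case makes `1 - ε / 2` nonnegative; in the second, `1 - ε ≤ 0`.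
  · rcases le_total ε 1 with h1 | h1
    · have : (1 - ε / 2) * (1 - η) ≤ (1 - ε / 2) * euclNorm y :=
        mul_le_mul_of_nonneg_left (by linarith) (by linarith)
      nlinarith
    · linarith
  · have : (1 + ε / 2) * euclNorm y ≤ (1 + ε / 2) * (1 + η) :=
      mul_le_mul_of_nonneg_left (by linarith) (by linarith)
    nlinarith

/-! ### Net size and the union bound -/

/-- Parameters for which the mixture net is fine enough, yet of size polynomial in
`N * K * ε⁻¹ * δ⁻¹`. -/
lemma exists_net_parameters {N K : ℕ} (hN : 2 ≤ N) (hK : 1 ≤ K) {ε δ : ℝ} (hε : 0 < ε)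
    (hεN : ε ≤ √(N : ℝ)) (hδ : 0 < δ) (hδ1 : δ ≤ 1) :
    ∃ D L : ℕ, 1 ≤ D ∧ 1 ≤ L ∧ δ⁻¹ ≤ D ∧ K * (3 * D * N / L) ≤ ε / (8 * √(N : ℝ)) ∧
      (7 * L * (2 * (D * L) + 1) ^ 2 : ℝ) ≤ (N * K * ε⁻¹ * δ⁻¹) ^ 64 ∧
      2 ≤ (N * K * ε⁻¹ * δ⁻¹) ^ 2 ∧ 1 ≤ N * K * ε⁻¹ * δ⁻¹ := by
  have hN2 : (2 : ℝ) ≤ N := by exact_mod_cast hN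
  have hK1 : (1 : ℝ) ≤ K := by exact_mod_cast hK
  have hs2 : √(N : ℝ) * √(N : ℝ) = N := Real.mul_self_sqrt (by linarith)
  have hs1 : 1 ≤ √(N : ℝ) := Real.one_le_sqrt.2 (by linarith)
  set s := √(N : ℝ)
  set u : ℝ := N * K * ε⁻¹ with hu
  set d : ℝ := δ⁻¹ with hd
  have hd1 : 1 ≤ d := (one_le_inv₀ hδ).2 hδ1
  -- Since `ε ≤ √N`, one gets `Q ≥ √N ≥ √2`, so powers of `Q ^ 2 ≥ 2` can absorb numerical
  -- constants.
  have hus : s ≤ u := by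
    rw [hu, ← div_eq_mul_inv, le_div_iff₀ hε]
    calc s * ε ≤ s * s := by gcongr
      _ = N * 1 := by rw [hs2, mul_one]
      _ ≤ N * K := by gcongr
  have hu1 : 1 ≤ u := hs1.trans hus
  set Q := u * d
  have huQ : u ≤ Q := le_mul_of_one_le_right (by linarith) hd1
  have hdQ : d ≤ Q := le_mul_of_one_le_left (by linarith) hu1
  have hsQ : s ≤ Q := hus.trans huQ
  have hQ1 : 1 ≤ Q := hs1.trans hsQ
  have hQ2 : 2 ≤ Q ^ 2 := by nlinarith
  have hD : d ≤ (⌈d⌉₊ : ℝ) := Nat.le_ceil d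
  have hD2 : (⌈d⌉₊ : ℝ) ≤ 2 * d := by linarith [(Nat.ceil_lt_add_one (by linarith : 0 ≤ d)).le]
  generalize ⌈d⌉₊ = D at hD hD2
  have hD1 : (1 : ℝ) ≤ D := hd1.trans hD
  have hDus : 1 ≤ (D : ℝ) * u * s := by
    calc (1 : ℝ) = 1 * 1 * 1 := by norm_num
      _ ≤ (D : ℝ) * u * s := by gcongr
  -- The mesh condition amounts to `L ≥ 24 * D * u * s`.
  have hL : 24 * (D * u * s) ≤ (⌈24 * (D * u * s)⌉₊ : ℝ) := Nat.le_ceil _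
  have hL2 : (⌈24 * (D * u * s)⌉₊ : ℝ) ≤ 48 * (D * u * s) := by
    linarith [(Nat.ceil_lt_add_one (by linarith : 0 ≤ 24 * (D * u * s))).le]
  generalize ⌈24 * (D * u * s)⌉₊ = L at hL hL2
  have hL1 : (1 : ℝ) ≤ L := by linarith
  have hLQ : (L : ℝ) ≤ 96 * Q ^ 2 := by
    calc (L : ℝ) ≤ 48 * (D * u * s) := hL2
      _ ≤ 48 * ((2 * d) * u * Q) := by gcongr
      _ = 96 * Q ^ 2 := by simp only [Q]; ring
  have hDQ : (D : ℝ) ≤ 2 * Q := by linarith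
  refine ⟨D, L, by exact_mod_cast hD1, by exact_mod_cast hL1, hD, ?_, ?_, hQ2, hQ1⟩
  · rw [← mul_div_assoc, div_le_div_iff₀ (by linarith) (by linarith)]
    have : ε * (24 * (D * u * s)) = K * (3 * D * N) * (8 * s) := by
      rw [hu]; field_simp; ring
    rw [← this]
    gcongr
  · have hDL : (1 : ℝ) ≤ D * L := by nlinarith
    calc (7 * L * (2 * (D * L) + 1) ^ 2 : ℝ) ≤ 7 * L * (3 * (D * L)) ^ 2 := by
          gcongr; linarith
      _ = 63 * (D : ℝ) ^ 2 * (L : ℝ) ^ 3 := by ring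
      _ ≤ 63 * (2 * Q) ^ 2 * (96 * Q ^ 2) ^ 3 := by gcongr
      -- `63 * 4 * 96 ^ 3 < 2 ^ 28`.
      _ ≤ 2 ^ 28 * Q ^ 8 := by
          have : 0 ≤ Q ^ 8 := by positivity
          nlinarith
      _ ≤ (Q ^ 2) ^ 28 * Q ^ 8 := by gcongr
      _ = Q ^ 64 := by ring

lemma union_bound_le {K : ℕ} (hK : 1 ≤ K) {B Q c m : ℝ} (hB0 : 0 ≤ B) (hB : B ≤ Q ^ 64)
    (hQ2 : 2 ≤ Q ^ 2) (hQ1 : 1 ≤ Q) (hc : 0 < c) (hm : (66 + c) * K * Real.log Q ≤ m) :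
    B ^ K * (2 * Real.exp (-m)) ≤ Q ^ (-c) := by
  have hQ0 : 0 < Q := by linarith
  have hK1 : (1 : ℝ) ≤ K := by exact_mod_cast hK
  have hlog : 0 ≤ Real.log Q := Real.log_nonneg hQ1
  have hpow : ∀ n : ℕ, Q ^ n = Real.exp (n * Real.log Q) := fun n => by
    rw [Real.exp_nat_mul, Real.exp_log hQ0]
  calc B ^ K * (2 * Real.exp (-m)) ≤ (Q ^ 64) ^ K * (Q ^ 2 * Real.exp (-m)) := by gcongr
    _ = Real.exp ((64 * K + 2) * Real.log Q - m) := by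
        rw [← pow_mul, hpow, hpow, ← Real.exp_add, ← Real.exp_add]
        congr 1; push_cast; ring
    -- Since `K ≥ 1`, `(66 + c) * K ≥ 64 * K + 2 + c`; the 2 pays for the two tails through `2 ≤ Q ^
    -- 2`.
    _ ≤ Real.exp (Real.log Q * -c) := by
        refine Real.exp_le_exp.2 ?_
        nlinarith [mul_nonneg (sub_nonneg.2 hK1) (mul_nonneg hc.le hlog),
          mul_nonneg (sub_nonneg.2 hK1) hlog]
    _ = Q ^ (-c) := (Real.rpow_def_of_pos hQ0 _).symm

lemma measure_biUnion_le_card_mul {α ι : Type*} [MeasurableSpace α] (μ : Measure α) (s : Finset ι)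
    (t : ι → Set α) {b : ENNReal} (h : ∀ i ∈ s, μ (t i) ≤ b) :
    μ (⋃ i ∈ s, t i) ≤ s.card * b :=
  (measure_biUnion_finset_le s t).trans
    ((Finset.sum_le_card_nsmul s _ b h).trans_eq (nsmul_eq_mul _ _))

lemma matrixLaw_not_isMixtureIsometry_le {M N K D L : ℕ} (hM : 1 ≤ M) (hN : 1 ≤ N) (hD : 1 ≤ D)
    (hL : 1 ≤ L) {h : Fin N → ℂ} (hh : ∑ n, ‖h n‖ ^ 2 = 1) {δ ε : ℝ} (hδ : 0 < δ) (hδD : δ⁻¹ ≤ D)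
    (hε : 0 < ε) (hεN : ε ≤ √(N : ℝ)) (hmesh : K * (3 * D * N / L) ≤ ε / (8 * √(N : ℝ))) :
    matrixLaw M N {A | ¬ IsMixtureIsometry K h δ ε (Matrix.of A)} ≤
      ENNReal.ofReal ((7 * L * (2 * (D * L) + 1) ^ 2 : ℝ) ^ K *
        (2 * Real.exp (-(M * (ε / 2) ^ 2 / 8)))) := by
  set bad : (Fin N → ℂ) → Set (Fin M → Fin N → ℂ) := fun y =>
    {A | ¬ ((1 - ε / 2) * euclNorm y ≤ scaledNorm (Matrix.of A) y ∧
      scaledNorm (Matrix.of A) y ≤ (1 + ε / 2) * euclNorm y)} with hbad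
  -- The inclusion holds only almost everywhere: passing from net to mixtures needs the entries to
  -- be genuine weights.
  have hsub : {A : Fin M → Fin N → ℂ | ¬ IsMixtureIsometry K h δ ε (Matrix.of A)} ≤ᵐ[matrixLaw M N]
      ⋃ y ∈ mixtureNet K h D L, bad y := by
    filter_upwards [ae_matrix_mem M N] with A hA hnot
    by_contra hcon
    refine hnot (isMixtureIsometry_of_net hM hN hD hL hh hδ hδD hε hεN hmesh hA fun y hy => ?_)
    by_contra hy'
    exact hcon (Set.mem_biUnion hy hy')
  refine (measure_mono_ae hsub).trans ((measure_biUnion_le_card_mul _ _ _ fun y _ =>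
    matrixLaw_not_near_isometry_le hM hN y (half_pos hε)).trans ?_)
  rw [ENNReal.ofReal_mul (p := (7 * L * (2 * (D * L) + 1) ^ 2 : ℝ) ^ K) (by positivity)]
  refine mul_le_mul' ?_ le_rfl
  rw [← ENNReal.ofReal_natCast]
  refine ENNReal.ofReal_le_ofReal ?_
  exact_mod_cast card_mixtureNet_le K h D L

end CompressiveSinusoids

end

theorem theorem4 :
    ∀ c : ℝ, 0 < c → ∃ C : ℝ, 0 < C ∧
      ∀ (N K M : ℕ), 1 ≤ K → 1 ≤ M →
      ∀ h : Fin N → ℂ, (∑ n, ‖h n‖ ^ 2 = 1) → (∃ m n, m ≠ n ∧ h m ≠ 0 ∧ h n ≠ 0) →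
      ∀ ε δ : ℝ, 0 < ε → 0 < δ →
      C * (ε⁻¹ ^ 2 * K * Real.log (N * K * ε⁻¹ * δ⁻¹)) ≤ M →
      ∀ (Ω : Type*) [MeasurableSpace Ω] (P : Measure Ω) [IsProbabilityMeasure P]
        (A : Ω → Matrix (Fin M) (Fin N) ℂ),
        CompressiveSinusoids.IsRandomMeasurementMatrix P A →
        P {x | ¬ CompressiveSinusoids.IsMixtureIsometry K h δ ε (A x)} ≤
          ENNReal.ofReal ((N * K * ε⁻¹ * δ⁻¹) ^ (-c)) := by
  intro c hc
  -- The tail exponent at deviation `ε / 2` is `M * (ε / 2) ^ 2 / 8 = M * ε ^ 2 / 32`.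
  refine ⟨32 * (66 + c), by positivity, ?_⟩
  intro N K M hK hM h hh hnz ε δ hε hδ hMC Ω _ P _ A hA
  open CompressiveSinusoids in
  refine (hA.measure_le fun B => ¬ IsMixtureIsometry K h δ ε B).trans ?_
  -- Two nonzero window entries force `N ≥ 2`, which keeps `Q` bounded away from 1 in the main case.
  have hN : 2 ≤ N := by
    obtain ⟨m, n, hmn, -⟩ := hnz
    have := Fin.val_ne_of_ne hmn
    omega
  have hN1 : 1 ≤ N := by omega
  open CompressiveSinusoids in
  rcases lt_or_ge 1 δ with hδ1 | hδ1
  · have : ∀ B : Fin M → Fin N → ℂ, IsMixtureIsometry K h δ ε (Matrix.of B) := fun B w hw =>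
      absurd (le_one_of_mem_wellConditioned hK hh hw) (not_le.2 hδ1)
    simp [this]
  rcases le_total (√(N : ℝ)) ε with hεN | hεN
  · have h0 : matrixLaw M N {B | ¬ IsMixtureIsometry K h δ ε (Matrix.of B)} = 0 := by
      refine ae_iff.1 ?_
      filter_upwards [ae_matrix_mem M N] with B hB
      exact isMixtureIsometry_of_sqrt_le hM hN1 hδ hεN hB
    rw [h0]
    exact zero_le
  obtain ⟨D, L, hD, hL, hδD, hmesh, hB, hQ2, hQ1⟩ :=
    exists_net_parameters hN hK hε hεN hδ hδ1
  refine (matrixLaw_not_isMixtureIsometry_le hM hN1 hD hL hh hδ hδD hε hεN hmesh).trans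
    (ENNReal.ofReal_le_ofReal (union_bound_le hK (by positivity) hB hQ2 hQ1 hc ?_))
  have h1 := mul_le_mul_of_nonneg_right hMC (by positivity : 0 ≤ ε ^ 2 / 32)
  have h2 : 32 * (66 + c) * (ε⁻¹ ^ 2 * K * Real.log (N * K * ε⁻¹ * δ⁻¹)) * (ε ^ 2 / 32) =
      (66 + c) * K * Real.log (N * K * ε⁻¹ * δ⁻¹) * (ε⁻¹ * ε) ^ 2 := by ring
  rw [h2, inv_mul_cancel₀ hε.ne', one_pow, mul_one] at h1
  refine h1.trans_eq ?_
  ring
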